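/- Let $d\ge 3$, let $\mathbb S^{d-1}\subset\mathbb R^d$ be the unit sphere with surface measure $\omega_d$, gradient $\nabla$ and Laplace--Beltrami operator $\Delta$, and let $\mathbb P_N$ be the space of restrictions to $\mathbb S^{d-1}$ of real polynomials in $d$ variables of total degree at most $N$. For each $\ell\ge0$ let $Z(d,\ell)$ be the dimension of the space of spherical harmonics of degree $\ell$ (the restrictions to $\mathbb S^{d-1}$ of the harmonic homogeneous polynomials of degree $\ell$), and let $\{Y_{\ell,k}: \ell\ge 0,\ 1\le k\le Z(d,\ell)\}$ be an $L^2(\mathbb S^{d-1})$-orthonormal family of real spherical harmonics, $Y_{\ell,k}$ being of degree $\ell$. Let $x_1,\dots,x_m\in\mathbb S^{d-1}$ be quadrature points with weights $w_1,\dots,w_m>0$. The rule has exactness degree $t$ if $\sum_{j=1}^m w_jg(x_j)=\int_{\mathbb S^{d-1}}g\,\mathrm d\omega_d$ for all $g\in\mathbb P_t$. For $N\ge 0$ define the hyperinterpolation operator $$\mathcal L_Nf=\sum_{\ell=0}^N\sum_{k=1}^{Z(d,\ell)}\Big(\sum_{j=1}^m w_jf(x_j)Y_{\ell,k}(x_j)\Big)Y_{\ell,k}.$$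 Let $\tau>0$, $\nu\in\mathbb R$, $u_0:\mathbb S^{d-1}\to\mathbb R$, and let $u^n\in\mathbb P_N$ $(n\ge0)$ satisfy $$\frac{u^{n+1}-u^n}{\tau}=\nu^2\Delta u^{n+1}-\mathcal L_N\big((u^n)^3-u^n\big)\quad(n\ge0),\qquad u^0=\mathcal L_Nu_0 .$$ With $F(s)=\frac14(s^2-1)^2$ put $$\mathcal E(u)=\int_{\mathbb S^{d-1}}\Big(\frac{\nu^2}2|\nabla u|^2+F(u)\Big)\mathrm d\omega_d,\qquad \tilde{\mathcal E}(u)=\sum_{j=1}^m w_j\Big(\frac{\nu^2}2|\nabla u(x_j)|^2+F(u(x_j))\Big),$$ and let $\|u\|_\infty=\operatorname{ess\,sup}_{\mathbb S^{d-1}}|u|$. Then, for every $n\ge0$: (i) if the quadrature rule has exactness degree $2N$, then $$\tilde{\mathcal E}(u^{n+1})-\tilde{\mathcal E}(u^n)+\Big(\frac1\tau+\frac12\Big)\sum_{j=1}^m w_j\big(u^{n+1}(x_j)-u^n(x_j)\big)^2\le\frac32\max\{\|u^n\|_\infty^2,\|u^{n+1}\|_\infty^2\}\sum_{j=1}^m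 w_j\big(u^{n+1}(x_j)-u^n(x_j)\big)^2;$$ (ii) if the quadrature rule has exactness degree $4N$, then $$\mathcal E(u^{n+1})-\mathcal E(u^n)+\Big(\frac1\tau+\frac12\Big)\int_{\mathbb S^{d-1}}(u^{n+1}-u^n)^2\,\mathrm d\omega_d\le\frac32\max\{\|u^n\|_\infty^2,\|u^{n+1}\|_\infty^2\}\int_{\mathbb S^{d-1}}(u^{n+1}-u^n)^2\,\mathrm d\omega_d .$$ -/

import Mathlib

open MeasureTheory

noncomputable section

namespace AllenCahnSphere

/-- The unit sphere of `ℝ^d` with the Euclidean norm. -/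
abbrev S (d : ℕ) : Type := Metric.sphere (0 : EuclideanSpace ℝ (Fin d)) 1

/-- The surface measure on the unit sphere, of total mass `d * volume (unit ball)`, which is the
surface area of the sphere. -/
def surfaceMeasure (d : ℕ) : Measure (S d) :=
  (volume : Measure (EuclideanSpace ℝ (Fin d))).toSphere

/-! ### Differential operators on the sphere -/

/-- The extension of a function on the sphere to `ℝ^d` (minus the origin) that is constant along
rays, that is `y ↦ u (y / ‖y‖)`. -/
def radialExt {d : ℕ} (u : S d → ℝ) (y : EuclideanSpace ℝ (Fin d)) : ℝ :=
  open Classical in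
  if h : ‖y‖⁻¹ • y ∈ Metric.sphere (0 : EuclideanSpace ℝ (Fin d)) 1 then u ⟨‖y‖⁻¹ • y, h⟩ else 0

/-- The surface gradient: the gradient on the sphere of the extension that is constant along rays.
It is the tangential gradient, as the radial derivative of the extension vanishes. -/
def sphereGrad {d : ℕ} (u : S d → ℝ) (x : S d) : EuclideanSpace ℝ (Fin d) :=
  gradient (radialExt u) (x : EuclideanSpace ℝ (Fin d))

/-- The Laplace--Beltrami operator of the sphere: the Laplacian of `ℝ^d`, evaluated on the sphere,
of the extension that is constant along rays. -/
def laplaceBeltrami {d : ℕ} (u : S d → ℝ) (x : S d) : ℝ :=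
  Laplacian.laplacian (radialExt u) (x : EuclideanSpace ℝ (Fin d))

/-! ### Spherical polynomials and spherical harmonics -/

/-- The restriction to the sphere of a polynomial in `d` variables. -/
def restrictToSphere (d : ℕ) : MvPolynomial (Fin d) ℝ →ₗ[ℝ] (S d → ℝ) where
  toFun p := fun x => MvPolynomial.eval (fun i => (x : EuclideanSpace ℝ (Fin d)) i) p
  map_add' p q := by
    funext x
    simp
  map_smul' c p := by
    funext x
    simp

/-- The spherical polynomials of degree at most `N`. -/
def sphericalPolynomials (d N : ℕ) : Submodule ℝ (S d → ℝ) :=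
  (MvPolynomial.restrictTotalDegree (Fin d) ℝ N).map (restrictToSphere d)

/-- The Laplacian on polynomials in `d` variables. -/
def polyLaplacian (d : ℕ) : MvPolynomial (Fin d) ℝ →ₗ[ℝ] MvPolynomial (Fin d) ℝ :=
  ∑ i : Fin d, (MvPolynomial.pderiv i).toLinearMap ∘ₗ (MvPolynomial.pderiv i).toLinearMap

/-- The spherical harmonics of degree `l`: the restrictions to the sphere of the polynomials that
are homogeneous of degree `l` and harmonic. -/
def sphericalHarmonics (d l : ℕ) : Submodule ℝ (S d → ℝ) :=
  (MvPolynomial.homogeneousSubmodule (Fin d) ℝ l ⊓ LinearMap.ker (polyLaplacian d)).map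
    (restrictToSphere d)

/-- The dimension `Z(d, l)` of the space of spherical harmonics of degree `l`. -/
def Z (d l : ℕ) : ℕ := Module.finrank ℝ (sphericalHarmonics d l)

/-- The `L²` inner product of real-valued functions on the sphere. -/
def l2Inner {d : ℕ} (v z : S d → ℝ) : ℝ := ∫ x, v x * z x ∂(surfaceMeasure d)

/-- `Y l k`, for `l ∈ ℕ` and `Z(d, l)` many `k`, is a collection of `L²`-orthonormal real-valued
spherical harmonics, where `Y l k` has degree `l`. -/
structure IsHarmonicBasis {d : ℕ} (Y : (l : ℕ) → Fin (Z d l) → S d → ℝ) : Prop where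
  mem : ∀ l k, Y l k ∈ sphericalHarmonics d l
  orthonormal : ∀ a b : (l : ℕ) × Fin (Z d l),
    l2Inner (Y a.1 a.2) (Y b.1 b.2) = if a = b then 1 else 0

/-! ### Quadrature rules and hyperinterpolation -/

/-- An `m`-point quadrature rule on the sphere with positive weights. -/
structure QuadratureRule (d m : ℕ) where
  point : Fin m → S d
  weight : Fin m → ℝ
  weight_pos : ∀ j, 0 < weight j

/-- The quadrature sum `∑ j, w_j g(x_j)`. -/
def QuadratureRule.sum {d m : ℕ} (Q : QuadratureRule d m) (g : S d → ℝ) : ℝ :=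
  ∑ j, Q.weight j * g (Q.point j)

/-- The rule integrates every spherical polynomial of degree at most `t` exactly. -/
def QuadratureRule.HasExactness {d m : ℕ} (Q : QuadratureRule d m) (t : ℕ) : Prop :=
  ∀ g ∈ sphericalPolynomials d t, Q.sum g = ∫ x, g x ∂(surfaceMeasure d)

/-- The discrete inner product `⟨v, z⟩_m`. -/
def QuadratureRule.inner {d m : ℕ} (Q : QuadratureRule d m) (v z : S d → ℝ) : ℝ :=
  Q.sum fun x => v x * z x

/-- The hyperinterpolation operator of degree `N`. -/
def hyperinterpolation {d m : ℕ} (Q : QuadratureRule d m) (Y : (l : ℕ) → Fin (Z d l) → S d → ℝ)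
    (N : ℕ) (f : S d → ℝ) (x : S d) : ℝ :=
  ∑ l ∈ Finset.range (N + 1), ∑ k : Fin (Z d l), Q.inner f (Y l k) * Y l k x

/-! ### The scheme and the energies -/

/-- The sequence `u` of spherical polynomials of degree at most `N` is generated by the scheme
`(u^{n+1} - u^n) / τ = ν² Δ u^{n+1} - L_N ((u^n)³ - u^n)`, `u^0 = L_N u_0`. -/
structure IsSchemeSolution {d m : ℕ} (Q : QuadratureRule d m)
    (Y : (l : ℕ) → Fin (Z d l) → S d → ℝ) (N : ℕ) (τ ν : ℝ) (u₀ : S d → ℝ)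
    (u : ℕ → S d → ℝ) : Prop where
  mem : ∀ n, u n ∈ sphericalPolynomials d N
  init : u 0 = hyperinterpolation Q Y N u₀
  step : ∀ n x, (u (n + 1) x - u n x) / τ =
    ν ^ 2 * laplaceBeltrami (u (n + 1)) x
      - hyperinterpolation Q Y N (fun y => u n y ^ 3 - u n y) x

/-- The double well potential. -/
def F (s : ℝ) : ℝ := 1 / 4 * (s ^ 2 - 1) ^ 2

/-- The energy `∫ (ν²/2 |∇u|² + F(u))`. -/
def energy {d : ℕ} (ν : ℝ) (u : S d → ℝ) : ℝ :=
  ∫ x, (1 / 2 * ν ^ 2 * ‖sphereGrad u x‖ ^ 2 + F (u x)) ∂(surfaceMeasure d)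

/-- The discrete energy `∑ j, w_j (ν²/2 ∇u(x_j)·∇u(x_j) + F(u(x_j)))`. -/
def discreteEnergy {d m : ℕ} (Q : QuadratureRule d m) (ν : ℝ) (u : S d → ℝ) : ℝ :=
  Q.sum fun x => ν ^ 2 / 2 * (Inner.inner ℝ (sphereGrad u x) (sphereGrad u x)) + F (u x)

/-- The uniform norm `ess sup |u|` on the sphere. -/
def supNorm {d : ℕ} (u : S d → ℝ) : ℝ := essSup (fun x => |u x|) (surfaceMeasure d)

end AllenCahnSphere

end

open AllenCahnSphere

noncomputable section

namespace AllenCahnSphere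

open MvPolynomial Laplacian Filter Topology

/-! Test the scheme with e = u^{n+1} - u^n in the discrete inner product. Exactness 2N makes the `Y
l k` with l ≤ N orthonormal for that product, so L_N drops out against e ∈ P_N
(`inner_hyperinterpolation`), and the Laplacian becomes minus the quadrature sum of ∇u^{n+1}·∇e
(`inner_laplaceBeltrami`). Two pointwise bounds, convexity for the implicit gradient term
(`half_inner_sub_le`) and Taylor expansion for the explicit potential (`F_sub_le`), then give (i).
Under exactness 4N the quadrature evaluates the energy and the integral of e² exactly, so (ii) is
(i) rewritten.

The discrete Green identity needs no integration by parts. Every element of P_N is a sum of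
spherical harmonics (Fischer decomposition), and these are Laplace--Beltrami eigenfunctions. Hence
the Laplacian is symmetric for the discrete product on P_N and has quadrature sum zero on P_{2N};
the product rule for Δ(uv) does the rest. -/

variable {d : ℕ}

/-! ### Fischer decomposition of homogeneous polynomials -/

/-- The polynomial `∑ i, X_i ^ 2`. -/
def normSqPoly (d : ℕ) : MvPolynomial (Fin d) ℝ := ∑ i, X i ^ 2

theorem polyLaplacian_apply (p : MvPolynomial (Fin d) ℝ) :
    polyLaplacian d p = ∑ i, pderiv i (pderiv i p) := by
  simp [polyLaplacian]

theorem isHomogeneous_normSqPoly : (normSqPoly d).IsHomogeneous 2 :=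
  IsHomogeneous.sum _ _ _ fun i _ => by simpa using (isHomogeneous_X ℝ i).pow 2

theorem pderiv_normSqPoly (i : Fin d) : pderiv i (normSqPoly d) = 2 * X i := by
  simp [normSqPoly, pderiv_X, Pi.single_apply]

theorem isHomogeneous_polyLaplacian {p : MvPolynomial (Fin d) ℝ} {l : ℕ}
    (hp : p.IsHomogeneous l) : (polyLaplacian d p).IsHomogeneous (l - 2) := by
  rw [polyLaplacian_apply]
  exact IsHomogeneous.sum _ _ _ fun i _ => hp.pderiv.pderiv

/-- Leibniz rule: 2d is the Laplacian of |x|², and 4k comes from the cross terms by Euler's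
identity. -/
theorem polyLaplacian_normSqPoly_mul {f : MvPolynomial (Fin d) ℝ} {k : ℕ}
    (hf : f.IsHomogeneous k) :
    polyLaplacian d (normSqPoly d * f) =
      normSqPoly d * polyLaplacian d f + C ((4 * k + 2 * d : ℝ)) * f := by
  have h : ∀ i : Fin d, pderiv i (pderiv i (normSqPoly d * f)) =
      normSqPoly d * pderiv i (pderiv i f) + 4 * (X i * pderiv i f) + 2 * f := by
    intro i
    have h2 : pderiv i (2 : MvPolynomial (Fin d) ℝ) = 0 := by
      rw [← map_ofNat C 2, pderiv_C]
    simp only [pderiv_mul, pderiv_normSqPoly, map_add, h2, pderiv_X_self]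
    ring
  rw [polyLaplacian_apply, polyLaplacian_apply, Finset.sum_congr rfl fun i _ => h i,
    Finset.sum_add_distrib, Finset.sum_add_distrib, ← Finset.mul_sum, ← Finset.mul_sum,
    hf.sum_X_mul_pderiv]
  simp only [Finset.sum_const, Finset.card_univ, Fintype.card_fin, map_add, map_mul, map_natCast,
    nsmul_eq_mul, map_ofNat]
  ring

theorem polyLaplacian_normSqPoly_pow_mul {h : MvPolynomial (Fin d) ℝ} {k : ℕ}
    (hh : h.IsHomogeneous k) (h0 : polyLaplacian d h = 0) (j : ℕ) :
    polyLaplacian d (normSqPoly d ^ (j + 1) * h) =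
      C ((2 * (j + 1) * (2 * j + 2 * k + d) : ℝ)) * (normSqPoly d ^ j * h) := by
  induction j with
  | zero =>
    rw [zero_add, pow_one, polyLaplacian_normSqPoly_mul hh, h0]
    simp only [pow_zero, mul_zero, zero_add, one_mul, CharP.cast_eq_zero]
    congr 2; ring
  | succ j ih =>
    -- The previous lemma is applied to all but one factor |x|², a polynomial of degree 2(j+1) + k.
    have hom : (normSqPoly d ^ (j + 1) * h).IsHomogeneous (2 * (j + 1) + k) :=
      (isHomogeneous_normSqPoly.pow (j + 1)).mul hh
    rw [pow_succ', mul_assoc, polyLaplacian_normSqPoly_mul hom, ih]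
    push_cast
    simp only [map_add, map_mul, map_natCast, map_ofNat, map_one]
    ring

/-- The span of the products `|x|^(2j) h` of degree `l`, with `h` homogeneous and harmonic. -/
def harmonicSum (d l : ℕ) : Submodule ℝ (MvPolynomial (Fin d) ℝ) :=
  Submodule.span ℝ {p | ∃ j k h, 2 * j + k = l ∧ IsHomogeneous h k ∧ polyLaplacian d h = 0 ∧
    p = normSqPoly d ^ j * h}

/-- The Laplacian sends |x|^(2j+2) h to a multiple of |x|^(2j) h, nonzero since d > 0; dividing by
it gives a preimage. -/
theorem exists_polyLaplacian_eq (hd : 0 < d) {l : ℕ} {q : MvPolynomial (Fin d) ℝ}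
    (hq : q ∈ harmonicSum d l) :
    ∃ p ∈ harmonicSum d (l + 2), p.IsHomogeneous (l + 2) ∧ polyLaplacian d p = q := by
  induction hq using Submodule.span_induction with
  | mem q hq =>
    obtain ⟨j, k, h, hl, hh, h0, rfl⟩ := hq
    have hc : (2 * (j + 1) * (2 * j + 2 * k + d) : ℝ) ≠ 0 := by positivity
    refine ⟨(2 * (j + 1) * (2 * j + 2 * k + d) : ℝ)⁻¹ • (normSqPoly d ^ (j + 1) * h),
      Submodule.smul_mem _ _ (Submodule.subset_span ⟨j + 1, k, h, by omega, hh, h0, rfl⟩),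
      ?_, ?_⟩
    · have := (isHomogeneous_normSqPoly.pow (j + 1)).mul hh
      rw [show 2 * (j + 1) + k = l + 2 by omega] at this
      exact (homogeneousSubmodule (Fin d) ℝ (l + 2)).smul_mem _ this
    · rw [map_smul, polyLaplacian_normSqPoly_pow_mul hh h0, ← smul_eq_C_mul, smul_smul,
        inv_mul_cancel₀ hc, one_smul]
  | zero => exact ⟨0, zero_mem _, isHomogeneous_zero _ _ _, map_zero _⟩
  | add q q' _ _ ih ih' =>
    obtain ⟨p, hp, hom, rfl⟩ := ih
    obtain ⟨p', hp', hom', rfl⟩ := ih'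
    exact ⟨p + p', add_mem hp hp', hom.add hom', map_add _ _ _⟩
  | smul c q _ ih =>
    obtain ⟨p, hp, hom, rfl⟩ := ih
    exact ⟨c • p, Submodule.smul_mem _ _ hp,
      (homogeneousSubmodule (Fin d) ℝ (l + 2)).smul_mem _ hom, map_smul _ _ _⟩

theorem mem_harmonicSum_of_harmonic {l : ℕ} {p : MvPolynomial (Fin d) ℝ}
    (hp : p.IsHomogeneous l) (h0 : polyLaplacian d p = 0) : p ∈ harmonicSum d l :=
  Submodule.subset_span ⟨0, l, p, by simp, hp, h0, by simp⟩

/-- By induction Δp has a preimage q in the next harmonic sum, and p - q is harmonic. -/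
theorem IsHomogeneous.mem_harmonicSum (hd : 0 < d) (l : ℕ) {p : MvPolynomial (Fin d) ℝ}
    (hp : p.IsHomogeneous l) : p ∈ harmonicSum d l := by
  induction l using Nat.strong_induction_on generalizing p with
  | _ l ih =>
    -- In degrees 0 and 1 all first derivatives are constant, so p is itself harmonic.
    rcases Nat.lt_or_ge l 2 with hl | hl
    · refine mem_harmonicSum_of_harmonic hp ?_
      rw [polyLaplacian_apply]
      refine Finset.sum_eq_zero fun i _ => ?_
      have h1 : (pderiv i p).IsHomogeneous 0 := by
        have := hp.pderiv (i := i)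
        rwa [show l - 1 = 0 by omega] at this
      rw [← totalDegree_zero_iff_isHomogeneous, totalDegree_eq_zero_iff_eq_C] at h1
      rw [h1, pderiv_C]
    · obtain ⟨q, hq, hom, heq⟩ :=
        exists_polyLaplacian_eq hd (ih (l - 2) (by omega) (isHomogeneous_polyLaplacian hp))
      rw [Nat.sub_add_cancel hl] at hq hom
      have : p - q ∈ harmonicSum d l :=
        mem_harmonicSum_of_harmonic (hp.sub hom) (by rw [map_sub, heq, sub_self])
      simpa using add_mem this hq

/-! ### Spherical polynomials and spherical harmonics -/

theorem restrictToSphere_apply (p : MvPolynomial (Fin d) ℝ) (x : S d) :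
    restrictToSphere d p x = eval (fun i => (x : EuclideanSpace ℝ (Fin d)) i) p := rfl

theorem restrictToSphere_mul (p q : MvPolynomial (Fin d) ℝ) :
    restrictToSphere d (p * q) = restrictToSphere d p * restrictToSphere d q := by
  funext x; simp [restrictToSphere_apply]

theorem sum_sq_eq_norm_sq (y : EuclideanSpace ℝ (Fin d)) : ∑ i, y i ^ 2 = ‖y‖ ^ 2 := by
  simp [EuclideanSpace.norm_sq_eq]

theorem restrictToSphere_normSqPoly_pow_mul (j : ℕ) (h : MvPolynomial (Fin d) ℝ) :
    restrictToSphere d (normSqPoly d ^ j * h) = restrictToSphere d h := by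
  funext x
  have : ‖(x : EuclideanSpace ℝ (Fin d))‖ = 1 := by simp
  simp [restrictToSphere_apply, normSqPoly, sum_sq_eq_norm_sq, this]

theorem sphericalHarmonics_le_sphericalPolynomials (l : ℕ) :
    sphericalHarmonics d l ≤ sphericalPolynomials d l :=
  Submodule.map_mono fun _ hp => (mem_restrictTotalDegree _ _ _).2 hp.1.totalDegree_le

theorem sphericalPolynomials_mono {m n : ℕ} (h : m ≤ n) :
    sphericalPolynomials d m ≤ sphericalPolynomials d n :=
  Submodule.map_mono fun p hp => by
    rw [mem_restrictTotalDegree] at hp ⊢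
    exact hp.trans h

/-- On the sphere the factors |x|^(2j) equal 1, so the Fischer decomposition becomes one into
spherical harmonics of degree at most N. -/
theorem sphericalPolynomials_le (hd : 0 < d) (N : ℕ) {W : Submodule ℝ (S d → ℝ)}
    (hW : ∀ l ≤ N, sphericalHarmonics d l ≤ W) : sphericalPolynomials d N ≤ W := by
  have key : ∀ l ≤ N, harmonicSum d l ≤ W.comap (restrictToSphere d) := by
    intro l hl
    refine Submodule.span_le.2 ?_
    rintro _ ⟨j, k, h, hk, hh, h0, rfl⟩
    rw [SetLike.mem_coe, Submodule.mem_comap, restrictToSphere_normSqPoly_pow_mul]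
    exact hW k (by omega) ⟨h, ⟨hh, h0⟩, rfl⟩
  rintro _ ⟨p, hp, rfl⟩
  rw [SetLike.mem_coe, mem_restrictTotalDegree] at hp
  rw [← sum_homogeneousComponent p, map_sum]
  refine Submodule.sum_mem _ fun l hl => ?_
  exact key l (by rw [Finset.mem_range] at hl; omega)
    (IsHomogeneous.mem_harmonicSum hd l (homogeneousComponent_isHomogeneous l p))

theorem mul_mem_sphericalPolynomials {m n : ℕ} {u v : S d → ℝ}
    (hu : u ∈ sphericalPolynomials d m) (hv : v ∈ sphericalPolynomials d n) :
    u * v ∈ sphericalPolynomials d (m + n) := by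
  obtain ⟨p, hp, rfl⟩ := hu
  obtain ⟨q, hq, rfl⟩ := hv
  rw [SetLike.mem_coe, mem_restrictTotalDegree] at hp hq
  refine ⟨p * q, ?_, restrictToSphere_mul p q⟩
  rw [SetLike.mem_coe, mem_restrictTotalDegree]
  exact (totalDegree_mul p q).trans (add_le_add hp hq)

theorem const_mem_sphericalPolynomials (c : ℝ) (n : ℕ) :
    (fun _ => c) ∈ sphericalPolynomials d n :=
  ⟨C c, by simp [mem_restrictTotalDegree], by funext x; simp [restrictToSphere_apply]⟩

instance finiteDimensional_sphericalPolynomials (n : ℕ) :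
    FiniteDimensional ℝ (sphericalPolynomials d n) := by
  unfold sphericalPolynomials; infer_instance

instance finiteDimensional_sphericalHarmonics (n : ℕ) :
    FiniteDimensional ℝ (sphericalHarmonics d n) :=
  Submodule.finiteDimensional_of_le (sphericalHarmonics_le_sphericalPolynomials n)

theorem sphericalHarmonics_zero_eq : sphericalHarmonics d 0 = Submodule.span ℝ {1} := by
  apply le_antisymm
  · rintro _ ⟨p, ⟨hp, -⟩, rfl⟩
    rw [SetLike.mem_coe, mem_homogeneousSubmodule, ← totalDegree_zero_iff_isHomogeneous,
      totalDegree_eq_zero_iff_eq_C] at hp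
    rw [hp, Submodule.mem_span_singleton]
    exact ⟨coeff 0 p, by funext x; simp [restrictToSphere_apply]⟩
  · rw [Submodule.span_singleton_le_iff_mem]
    refine ⟨1, ⟨isHomogeneous_one _ _, ?_⟩, by funext x; simp [restrictToSphere_apply]⟩
    simp [polyLaplacian_apply]

/-! ### Product rule for the Euclidean Laplacian -/

theorem laplacian_apply_basisFun (f : EuclideanSpace ℝ (Fin d) → ℝ)
    (x : EuclideanSpace ℝ (Fin d)) :
    Δ f x = ∑ i, fderiv ℝ (fderiv ℝ f) x (EuclideanSpace.basisFun (Fin d) ℝ i)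
      (EuclideanSpace.basisFun (Fin d) ℝ i) := by
  rw [InnerProductSpace.laplacian_eq_iteratedFDeriv_orthonormalBasis f
    (EuclideanSpace.basisFun (Fin d) ℝ)]
  simp [iteratedFDeriv_two_apply]

theorem fderiv_fderiv_mul {E : Type*} [NormedAddCommGroup E] [NormedSpace ℝ E] {f g : E → ℝ}
    {x : E} (hf : ContDiffAt ℝ 2 f x) (hg : ContDiffAt ℝ 2 g x) (v : E) :
    fderiv ℝ (fderiv ℝ (f * g)) x v v = f x * fderiv ℝ (fderiv ℝ g) x v v
      + g x * fderiv ℝ (fderiv ℝ f) x v v + 2 * (fderiv ℝ f x v * fderiv ℝ g x v) := by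
  have hev : ∀ {h : E → ℝ}, ContDiffAt ℝ 2 h x → ∀ᶠ y in 𝓝 x, DifferentiableAt ℝ h y := by
    intro h hh
    filter_upwards [hh.eventually (by simp)] with y hy
    exact hy.differentiableAt (by norm_num)
  have hd : ∀ {h : E → ℝ}, ContDiffAt ℝ 2 h x → DifferentiableAt ℝ (fderiv ℝ h) x := fun hh =>
    (hh.fderiv_right (m := 1) (by norm_num)).differentiableAt (by norm_num)
  have h1 : fderiv ℝ (f * g) =ᶠ[𝓝 x] fun y => f y • fderiv ℝ g y + g y • fderiv ℝ f y := by
    filter_upwards [hev hf, hev hg] with y h1 h2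
    exact fderiv_mul h1 h2
  have hf1 := hf.differentiableAt (by norm_num)
  have hg1 := hg.differentiableAt (by norm_num)
  rw [h1.fderiv_eq, fderiv_fun_add (hf1.fun_smul (hd hg)) (hg1.fun_smul (hd hf)),
    fderiv_fun_smul hf1 (hd hg), fderiv_fun_smul hg1 (hd hf)]
  simp
  ring

theorem inner_gradient {f g : EuclideanSpace ℝ (Fin d) → ℝ} (x : EuclideanSpace ℝ (Fin d)) :
    Inner.inner ℝ (gradient f x) (gradient g x) =
      ∑ i, fderiv ℝ f x (EuclideanSpace.basisFun (Fin d) ℝ i) *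
        fderiv ℝ g x (EuclideanSpace.basisFun (Fin d) ℝ i) := by
  rw [← (EuclideanSpace.basisFun (Fin d) ℝ).sum_inner_mul_inner]
  refine Finset.sum_congr rfl fun i _ => ?_
  rw [real_inner_comm (gradient g x)]
  simp only [gradient, InnerProductSpace.toDual_symm_apply]

theorem laplacian_mul {f g : EuclideanSpace ℝ (Fin d) → ℝ} {x : EuclideanSpace ℝ (Fin d)}
    (hf : ContDiffAt ℝ 2 f x) (hg : ContDiffAt ℝ 2 g x) :
    Δ (f * g) x = f x * Δ g x + g x * Δ f x
      + 2 * Inner.inner ℝ (gradient f x) (gradient g x) := by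
  rw [inner_gradient]
  simp only [laplacian_apply_basisFun, fderiv_fderiv_mul hf hg, Finset.sum_add_distrib,
    Finset.mul_sum]

/-! ### Polynomials as functions on Euclidean space -/

/-- The function on Euclidean space given by a polynomial. -/
def polyFun (p : MvPolynomial (Fin d) ℝ) (y : EuclideanSpace ℝ (Fin d)) : ℝ :=
  eval (fun i => y i) p

theorem polyFun_C (a : ℝ) : polyFun (d := d) (C a) = fun _ => a := by
  funext y; simp [polyFun]

theorem polyFun_X (i : Fin d) :
    polyFun (X i) = (EuclideanSpace.proj i : EuclideanSpace ℝ (Fin d) →L[ℝ] ℝ) := by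
  funext y; simp [polyFun]

theorem polyFun_add (p q : MvPolynomial (Fin d) ℝ) :
    polyFun (p + q) = polyFun p + polyFun q := by
  funext y; simp [polyFun]

theorem polyFun_mul (p q : MvPolynomial (Fin d) ℝ) :
    polyFun (p * q) = polyFun p * polyFun q := by
  funext y; simp [polyFun]

theorem hasFDerivAt_polyFun (p : MvPolynomial (Fin d) ℝ) (y : EuclideanSpace ℝ (Fin d)) :
    HasFDerivAt (polyFun p)
      (∑ i, polyFun (pderiv i p) y • (EuclideanSpace.proj i : EuclideanSpace ℝ (Fin d) →L[ℝ] ℝ))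
      y := by
  induction p using MvPolynomial.induction_on with
  | C a =>
    rw [polyFun_C]
    refine (hasFDerivAt_const a y).congr_fderiv ?_
    simp [polyFun]
  | add p q hp hq =>
    rw [polyFun_add]
    refine (hp.add hq).congr_fderiv ?_
    simp [polyFun, add_smul, Finset.sum_add_distrib]
  | mul_X p j hp =>
    rw [polyFun_mul, polyFun_X]
    refine (hp.mul (ContinuousLinearMap.hasFDerivAt _)).congr_fderiv ?_
    ext v
    simp [polyFun, pderiv_X, Pi.single_apply, add_mul, Finset.sum_add_distrib, mul_assoc,
      Finset.mul_sum, apply_ite]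

theorem fderiv_polyFun_apply (p : MvPolynomial (Fin d) ℝ) (y v : EuclideanSpace ℝ (Fin d)) :
    fderiv ℝ (polyFun p) y v = ∑ i, v i * polyFun (pderiv i p) y := by
  rw [(hasFDerivAt_polyFun p y).fderiv]
  simp [mul_comm]

theorem contDiff_polyFun (p : MvPolynomial (Fin d) ℝ) {n : WithTop ℕ∞} :
    ContDiff ℝ n (polyFun p) := by
  induction p using MvPolynomial.induction_on with
  | C a => rw [polyFun_C]; exact contDiff_const
  | add p q hp hq => rw [polyFun_add]; exact hp.add hq
  | mul_X p j hp => rw [polyFun_mul, polyFun_X]; exact hp.mul (ContinuousLinearMap.contDiff _)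

theorem laplacian_polyFun (p : MvPolynomial (Fin d) ℝ) :
    Δ (polyFun p) = polyFun (polyLaplacian d p) := by
  funext y
  have h : fderiv ℝ (polyFun p) = fun y => ∑ i, polyFun (pderiv i p) y •
      (EuclideanSpace.proj i : EuclideanSpace ℝ (Fin d) →L[ℝ] ℝ) :=
    funext fun y => (hasFDerivAt_polyFun p y).fderiv
  have h2 := HasFDerivAt.fun_sum (u := Finset.univ) fun (i : Fin d) _ =>
    (hasFDerivAt_polyFun (pderiv i p) y).smul_const
      (EuclideanSpace.proj i : EuclideanSpace ℝ (Fin d) →L[ℝ] ℝ)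
  rw [laplacian_apply_basisFun, polyLaplacian_apply, h, h2.fderiv]
  simp [polyFun]

theorem polyFun_smul {p : MvPolynomial (Fin d) ℝ} {l : ℕ} (hp : p.IsHomogeneous l) (c : ℝ)
    (y : EuclideanSpace ℝ (Fin d)) : polyFun p (c • y) = c ^ l * polyFun p y := by
  simp only [polyFun, eval_eq', Finset.mul_sum]
  refine Finset.sum_congr rfl fun m hm => ?_
  have : ∑ i, m i = l := by
    rw [← hp (mem_support_iff.1 hm), Finsupp.weight_apply, Finsupp.sum_fintype _ _ (by simp)]
    simp
  simp only [PiLp.smul_apply, smul_eq_mul, mul_pow, Finset.prod_mul_distrib,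
    Finset.prod_pow_eq_pow_sum, this]
  ring

/-! ### Powers of the norm -/

/-- The power `‖y‖ ^ (2 s)` of the norm. -/
def normPow (s : ℝ) (y : EuclideanSpace ℝ (Fin d)) : ℝ := (‖y‖ ^ 2) ^ s

theorem hasFDerivAt_normPow (s : ℝ) {y : EuclideanSpace ℝ (Fin d)} (hy : y ≠ 0) :
    HasFDerivAt (normPow s) ((2 * s * normPow (s - 1) y) • innerSL ℝ y) y := by
  have h := (hasStrictFDerivAt_norm_sq y).hasFDerivAt.rpow_const (p := s)
    (Or.inl (by positivity))
  refine h.congr_fderiv ?_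
  ext v
  simp [normPow]
  ring

theorem contDiffAt_normPow (s : ℝ) {y : EuclideanSpace ℝ (Fin d)} (hy : y ≠ 0)
    {n : WithTop ℕ∞} : ContDiffAt ℝ n (normPow s) y :=
  (contDiff_norm_sq ℝ).contDiffAt.rpow_const_of_ne (by positivity)

theorem gradient_normPow (s : ℝ) {x : EuclideanSpace ℝ (Fin d)} (hx : ‖x‖ = 1) :
    gradient (normPow s) x = (2 * s) • x := by
  have h0 : x ≠ 0 := fun h => by simp [h] at hx
  refine HasGradientAt.gradient ?_
  rw [hasGradientAt_iff_hasFDerivAt]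
  refine (hasFDerivAt_normPow s h0).congr_fderiv ?_
  ext v
  simp [normPow, hx]

theorem laplacian_normPow (s : ℝ) {x : EuclideanSpace ℝ (Fin d)} (hx : ‖x‖ = 1) :
    Δ (normPow s) x = 4 * s * (s - 1) + 2 * s * d := by
  have h0 : x ≠ 0 := fun h => by simp [h] at hx
  have h1 : fderiv ℝ (normPow s) =ᶠ[𝓝 x] fun y => (2 * s * normPow (s - 1) y) • innerSL ℝ y := by
    filter_upwards [isOpen_ne.mem_nhds h0] with y hy
    exact (hasFDerivAt_normPow s hy).fderiv
  have h2 := ((hasFDerivAt_normPow (s - 1) h0).const_mul (2 * s)).fun_smul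
    (innerSL ℝ (E := EuclideanSpace ℝ (Fin d))).hasFDerivAt
  rw [laplacian_apply_basisFun, h1.fderiv_eq, h2.fderiv]
  -- The trace of the identity contributes 2sd; the derivative of the scalar factor contributes
  -- 4s(s-1)|x|², with |x| = 1.
  have hs : ∑ i, x i * x i = 1 := by
    rw [← Finset.sum_congr rfl fun i _ => sq (x i), sum_sq_eq_norm_sq, hx, one_pow]
  trans ∑ i, (2 * s + 4 * s * (s - 1) * (x i * x i))
  · refine Finset.sum_congr rfl fun i _ => ?_
    change (2 * s * normPow (s - 1) x) * Inner.inner ℝ (EuclideanSpace.basisFun (Fin d) ℝ i)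
      (EuclideanSpace.basisFun (Fin d) ℝ i) + (2 * s * ((2 * (s - 1) * normPow (s - 1 - 1) x) *
      Inner.inner ℝ x (EuclideanSpace.basisFun (Fin d) ℝ i))) *
      Inner.inner ℝ x (EuclideanSpace.basisFun (Fin d) ℝ i) = _
    simp [normPow, hx, EuclideanSpace.inner_single_right]
    ring
  · rw [Finset.sum_add_distrib, Finset.sum_const, ← Finset.mul_sum, hs]
    simp
    ring

/-! ### Extensions constant along rays -/

theorem radialExt_apply_of_ne (u : S d → ℝ) {y : EuclideanSpace ℝ (Fin d)} (hy : y ≠ 0) :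
    ∃ h : ‖y‖⁻¹ • y ∈ Metric.sphere (0 : EuclideanSpace ℝ (Fin d)) 1,
      radialExt u y = u ⟨‖y‖⁻¹ • y, h⟩ := by
  have h : ‖y‖⁻¹ • y ∈ Metric.sphere (0 : EuclideanSpace ℝ (Fin d)) 1 := by
    simp [norm_smul, hy]
  exact ⟨h, dif_pos h⟩

theorem radialExt_coe (u : S d → ℝ) (x : S d) : radialExt u x = u x := by
  have hx : ‖(x : EuclideanSpace ℝ (Fin d))‖ = 1 := by simp
  simp [radialExt, hx]

theorem coe_ne_zero (x : S d) : (x : EuclideanSpace ℝ (Fin d)) ≠ 0 := by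
  have hx : ‖(x : EuclideanSpace ℝ (Fin d))‖ = 1 := by simp
  intro h
  simp [h] at hx

theorem radialExt_mul (u v : S d → ℝ) : radialExt (u * v) = radialExt u * radialExt v := by
  funext y
  simp only [radialExt, Pi.mul_apply]
  split_ifs <;> simp

theorem radialExt_add (u v : S d → ℝ) : radialExt (u + v) = radialExt u + radialExt v := by
  funext y
  simp only [radialExt, Pi.add_apply]
  split_ifs <;> simp

theorem radialExt_smul (c : ℝ) (u : S d → ℝ) : radialExt (c • u) = c • radialExt u := by
  funext y
  simp only [radialExt, Pi.smul_apply]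
  split_ifs <;> simp

theorem contDiffAt_radialExt {N : ℕ} {u : S d → ℝ} (hu : u ∈ sphericalPolynomials d N)
    (x : S d) : ContDiffAt ℝ 2 (radialExt u) (x : EuclideanSpace ℝ (Fin d)) := by
  obtain ⟨p, -, rfl⟩ := hu
  have h : radialExt (restrictToSphere d p) =ᶠ[𝓝 (x : EuclideanSpace ℝ (Fin d))]
      fun y => polyFun p (‖y‖⁻¹ • y) := by
    filter_upwards [isOpen_ne.mem_nhds (coe_ne_zero x)] with y hy
    obtain ⟨h, e⟩ := radialExt_apply_of_ne (restrictToSphere d p) hy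
    rw [e]; rfl
  refine ContDiffAt.congr_of_eventuallyEq ?_ h
  have h1 : ContDiffAt ℝ 2 (fun y : EuclideanSpace ℝ (Fin d) => ‖y‖⁻¹ • y) x :=
    ((contDiffAt_norm ℝ (coe_ne_zero x)).inv (by simp)).smul contDiffAt_id
  exact (contDiff_polyFun p).contDiffAt.comp _ h1

/-- By homogeneity p(y/|y|) = |y|^(-l) p(y); the exponent is halved because `normPow s` is the power
2s of the norm. -/
theorem radialExt_restrictToSphere_eventuallyEq {p : MvPolynomial (Fin d) ℝ} {l : ℕ}
    (hp : p.IsHomogeneous l) (x : S d) :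
    radialExt (restrictToSphere d p) =ᶠ[𝓝 (x : EuclideanSpace ℝ (Fin d))]
      normPow (-(l : ℝ) / 2) * polyFun p := by
  filter_upwards [isOpen_ne.mem_nhds (coe_ne_zero x)] with y hy
  obtain ⟨h, e⟩ := radialExt_apply_of_ne (restrictToSphere d p) hy
  have h0 : 0 ≤ ‖y‖ := norm_nonneg y
  rw [e, Pi.mul_apply, normPow, ← Real.rpow_natCast, ← Real.rpow_mul h0,
    show ((2 : ℕ) : ℝ) * (-(l : ℝ) / 2) = -(l : ℝ) by push_cast; ring, Real.rpow_neg h0,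
    Real.rpow_natCast, ← inv_pow, ← polyFun_smul hp]
  rfl

/-- Spherical harmonics are eigenfunctions of the Laplace--Beltrami operator. -/
theorem laplaceBeltrami_of_mem_sphericalHarmonics {l : ℕ} {u : S d → ℝ}
    (hu : u ∈ sphericalHarmonics d l) (x : S d) :
    laplaceBeltrami u x = -(l * (l + d - 2)) * u x := by
  obtain ⟨p, ⟨hp, h0⟩, rfl⟩ := hu
  rw [SetLike.mem_coe, mem_homogeneousSubmodule] at hp
  have hx : ‖(x : EuclideanSpace ℝ (Fin d))‖ = 1 := by simp
  have heuler : Inner.inner ℝ (x : EuclideanSpace ℝ (Fin d)) (gradient (polyFun p) x)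
      = l * polyFun p x := by
    rw [real_inner_comm, gradient, InnerProductSpace.toDual_symm_apply, fderiv_polyFun_apply]
    have := congrArg (fun q => polyFun q (x : EuclideanSpace ℝ (Fin d))) hp.sum_X_mul_pderiv
    simpa [polyFun] using this
  -- With s = -l/2 the norm power contributes l(l+2) - ld and the cross term -2l², by Euler's
  -- identity; Δp = 0 removes the rest.
  rw [laplaceBeltrami,
    (InnerProductSpace.laplacian_congr_nhds
      (radialExt_restrictToSphere_eventuallyEq hp x)).self_of_nhds,
    laplacian_mul (contDiffAt_normPow _ (coe_ne_zero x)) (contDiff_polyFun p).contDiffAt,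
    laplacian_polyFun, LinearMap.mem_ker.1 h0, laplacian_normPow _ hx, gradient_normPow _ hx,
    real_inner_smul_left, heuler]
  have hr : restrictToSphere d p x = polyFun p x := rfl
  rw [hr]
  simp only [normPow, polyFun, map_zero, mul_zero]
  ring

/-! ### Surface operators on spherical polynomials -/

section Operators

variable {N : ℕ} {u v : S d → ℝ}

theorem laplaceBeltrami_add (hu : u ∈ sphericalPolynomials d N)
    (hv : v ∈ sphericalPolynomials d N) :
    laplaceBeltrami (u + v) = laplaceBeltrami u + laplaceBeltrami v := by
  funext x
  rw [laplaceBeltrami, radialExt_add,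
    (contDiffAt_radialExt hu x).laplacian_add (contDiffAt_radialExt hv x)]
  rfl

theorem laplaceBeltrami_smul (c : ℝ) (hu : u ∈ sphericalPolynomials d N) :
    laplaceBeltrami (c • u) = c • laplaceBeltrami u := by
  funext x
  rw [laplaceBeltrami, radialExt_smul,
    InnerProductSpace.laplacian_smul c (contDiffAt_radialExt hu x)]
  rfl

theorem sphereGrad_sub (hu : u ∈ sphericalPolynomials d N) (hv : v ∈ sphericalPolynomials d N)
    (x : S d) : sphereGrad (u - v) x = sphereGrad u x - sphereGrad v x := by
  have hsub : radialExt (u - v) = radialExt u - radialExt v := by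
    rw [sub_eq_add_neg, ← neg_one_smul ℝ v, radialExt_add, radialExt_smul, neg_one_smul,
      sub_eq_add_neg]
  rw [sphereGrad, hsub, gradient, fderiv_sub
    ((contDiffAt_radialExt hu x).differentiableAt (by norm_num))
    ((contDiffAt_radialExt hv x).differentiableAt (by norm_num)), map_sub]
  rfl

/-- Radial extension is multiplicative, so the Euclidean product rule descends. It yields both
Green's identity and the polynomiality of |∇u|². -/
theorem laplaceBeltrami_mul (hu : u ∈ sphericalPolynomials d N)
    (hv : v ∈ sphericalPolynomials d N) (x : S d) :
    laplaceBeltrami (u * v) x = u x * laplaceBeltrami v x + v x * laplaceBeltrami u x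
      + 2 * Inner.inner ℝ (sphereGrad u x) (sphereGrad v x) := by
  rw [laplaceBeltrami, radialExt_mul,
    laplacian_mul (contDiffAt_radialExt hu x) (contDiffAt_radialExt hv x), radialExt_coe,
    radialExt_coe]
  rfl

theorem continuous_of_mem_sphericalPolynomials (hu : u ∈ sphericalPolynomials d N) :
    Continuous u := by
  obtain ⟨p, -, rfl⟩ := hu
  exact (contDiff_polyFun (n := 0) p).continuous.comp continuous_subtype_val

end Operators

/-! ### Surface measure and uniform norm -/

variable {m N : ℕ} {u v w : S d → ℝ} {Y : (l : ℕ) → Fin (Z d l) → S d → ℝ}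
  {Q : QuadratureRule d m}

instance : IsFiniteMeasure (surfaceMeasure d) := by unfold surfaceMeasure; infer_instance

instance : (surfaceMeasure d).IsOpenPosMeasure := by unfold surfaceMeasure; infer_instance

theorem integrable_of_continuous (hu : Continuous u) : Integrable u (surfaceMeasure d) :=
  hu.integrable_of_hasCompactSupport (HasCompactSupport.of_compactSpace u)

/-- Nonempty open sets have positive surface measure, so the essential bound holds everywhere, in
particular at the quadrature nodes. -/
theorem abs_le_supNorm (hu : Continuous u) (x : S d) : |u x| ≤ supNorm u := by
  -- Compactness bounds |u|, without which a real `essSup` need not dominate it.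
  obtain ⟨C, hC⟩ := isCompact_univ.exists_bound_of_continuousOn hu.continuousOn
  have hbdd : IsBoundedUnder (· ≤ ·) (ae (surfaceMeasure d)) fun x => |u x| :=
    isBoundedUnder_of ⟨C, fun x => hC x (Set.mem_univ x)⟩
  have hopen : IsOpen {x | supNorm u < |u x|} := isOpen_lt continuous_const hu.abs
  have hzero : surfaceMeasure d {x | supNorm u < |u x|} = 0 := by
    have := ae_le_essSup (μ := surfaceMeasure d) (f := fun x => |u x|) hbdd
    simpa [ae_iff, supNorm] using this
  by_contra! h
  have : x ∈ {x | supNorm u < |u x|} := h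
  rw [(hopen.measure_eq_zero_iff _).1 hzero] at this
  exact this

/-! ### Spans of orthonormal spherical harmonics -/

theorem IsHarmonicBasis.continuous (hY : IsHarmonicBasis Y) (l : ℕ) (k : Fin (Z d l)) :
    Continuous (Y l k) :=
  continuous_of_mem_sphericalPolynomials
    (sphericalHarmonics_le_sphericalPolynomials l (hY.mem l k))

theorem IsHarmonicBasis.linearIndependent (hY : IsHarmonicBasis Y) (l : ℕ) :
    LinearIndependent ℝ (Y l) := by
  rw [Fintype.linearIndependent_iff]
  intro c hc i
  have h1 : l2Inner (∑ k, c k • Y l k) (Y l i) = c i := by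
    have h2 : ∀ k, l2Inner (Y l k) (Y l i) = if k = i then 1 else 0 := fun k => by
      simpa using hY.orthonormal ⟨l, k⟩ ⟨l, i⟩
    have h3 : ∀ k, ∫ x, c k * (Y l k x * Y l i x) ∂(surfaceMeasure d) =
        c k * if k = i then 1 else 0 := fun k => by
      rw [integral_const_mul, ← h2 k]
      rfl
    simp only [l2Inner, Finset.sum_apply, Pi.smul_apply, smul_eq_mul, Finset.sum_mul, mul_assoc]
    rw [integral_finsetSum _ fun k _ =>
      (integrable_of_continuous (u := fun x => Y l k x * Y l i x)
        ((hY.continuous l k).mul (hY.continuous l i))).const_mul (c k)]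
    simp [h3]
  rw [← h1, hc]
  simp [l2Inner]

/-- Orthonormality gives independence, and there are exactly `Z d l` vectors. -/
theorem IsHarmonicBasis.span_eq (hY : IsHarmonicBasis Y) (l : ℕ) :
    Submodule.span ℝ (Set.range (Y l)) = sphericalHarmonics d l := by
  refine Submodule.eq_of_le_of_finrank_eq ?_ ?_
  · rw [Submodule.span_le]
    rintro _ ⟨k, rfl⟩
    exact hY.mem l k
  · rw [finrank_span_eq_card (hY.linearIndependent l), Fintype.card_fin]
    rfl

theorem IsHarmonicBasis.mem_sphericalPolynomials (hY : IsHarmonicBasis Y) {l : ℕ} (hl : l ≤ N)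
    (k : Fin (Z d l)) : Y l k ∈ sphericalPolynomials d N :=
  sphericalPolynomials_mono hl (sphericalHarmonics_le_sphericalPolynomials l (hY.mem l k))

/-- Reduces linear claims on P_N to the `Y l k`. Membership is carried along because additivity of
the surface Laplacian is known only for spherical polynomials. -/
theorem IsHarmonicBasis.induction (hY : IsHarmonicBasis Y) (hd : 0 < d)
    {motive : (S d → ℝ) → Prop} (basis : ∀ l ≤ N, ∀ k, motive (Y l k)) (zero : motive 0)
    (add : ∀ v ∈ sphericalPolynomials d N, ∀ w ∈ sphericalPolynomials d N,
      motive v → motive w → motive (v + w))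
    (smul : ∀ c : ℝ, ∀ v ∈ sphericalPolynomials d N, motive v → motive (c • v))
    (hu : u ∈ sphericalPolynomials d N) : motive u := by
  let W : Submodule ℝ (S d → ℝ) :=
    { carrier := {v | v ∈ sphericalPolynomials d N ∧ motive v}
      add_mem' := fun hv hw => ⟨add_mem hv.1 hw.1, add _ hv.1 _ hw.1 hv.2 hw.2⟩
      zero_mem' := ⟨zero_mem _, zero⟩
      smul_mem' := fun c _ hv => ⟨Submodule.smul_mem _ c hv.1, smul c _ hv.1 hv.2⟩ }
  refine (sphericalPolynomials_le hd N (W := W) (fun l hl => ?_) hu).2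
  rw [← hY.span_eq l, Submodule.span_le]
  rintro _ ⟨k, rfl⟩
  exact ⟨hY.mem_sphericalPolynomials hl k, basis l hl k⟩

theorem laplaceBeltrami_zero : laplaceBeltrami (0 : S d → ℝ) = 0 := by
  have := laplaceBeltrami_smul (0 : ℝ) (zero_mem (sphericalPolynomials d 0))
  simpa using this

theorem IsHarmonicBasis.laplaceBeltrami_eq (hY : IsHarmonicBasis Y) (l : ℕ) (k : Fin (Z d l)) :
    laplaceBeltrami (Y l k) = (-(l * (l + d - 2) : ℝ)) • Y l k :=
  funext fun x => laplaceBeltrami_of_mem_sphericalHarmonics (hY.mem l k) x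

theorem IsHarmonicBasis.laplaceBeltrami_mem (hY : IsHarmonicBasis Y) (hd : 0 < d)
    (hu : u ∈ sphericalPolynomials d N) : laplaceBeltrami u ∈ sphericalPolynomials d N := by
  refine hY.induction hd (motive := fun u => laplaceBeltrami u ∈ sphericalPolynomials d N)
    ?_ ?_ ?_ ?_ hu
  · intro l hl k
    rw [hY.laplaceBeltrami_eq]
    exact Submodule.smul_mem _ _ (hY.mem_sphericalPolynomials hl k)
  · rw [laplaceBeltrami_zero]
    exact zero_mem _
  · intro v hv w hw h1 h2
    rw [laplaceBeltrami_add hv hw]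
    exact add_mem h1 h2
  · intro c v hv h
    rw [laplaceBeltrami_smul c hv]
    exact Submodule.smul_mem _ c h

/-- The degree-0 basis function is a nonzero constant, and `Y l k` is orthogonal to it. -/
theorem IsHarmonicBasis.integral_eq_zero (hY : IsHarmonicBasis Y) (hd : 0 < d) {l : ℕ}
    (hl : l ≠ 0) (k : Fin (Z d l)) : ∫ x, Y l k x ∂(surfaceMeasure d) = 0 := by
  have hpos : 0 < Z d 0 := by
    -- The sphere is nonempty because d > 0, so degree 0 does have a basis function.
    have hne : (1 : S d → ℝ) ≠ 0 := fun h => by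
      have := congrFun h ⟨EuclideanSpace.single ⟨0, hd⟩ 1, by simp⟩
      simp at this
    rw [Z, sphericalHarmonics_zero_eq, finrank_span_singleton hne]
    exact one_pos
  obtain ⟨c, hc⟩ : ∃ c : ℝ, c • (1 : S d → ℝ) = Y 0 ⟨0, hpos⟩ := by
    have := hY.mem 0 ⟨0, hpos⟩
    rwa [sphericalHarmonics_zero_eq, Submodule.mem_span_singleton] at this
  have h0 := hY.orthonormal ⟨0, ⟨0, hpos⟩⟩ ⟨0, ⟨0, hpos⟩⟩
  have h1 := hY.orthonormal ⟨l, k⟩ ⟨0, ⟨0, hpos⟩⟩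
  rw [if_neg (fun h => hl (congrArg Sigma.fst h))] at h1
  simp only [l2Inner, ← hc, Pi.smul_apply, Pi.one_apply, smul_eq_mul, mul_one,
    integral_mul_const] at h0 h1
  rcases mul_eq_zero.1 h1 with h | h
  · exact h
  · simp [h] at h0

/-! ### Quadrature sums -/

namespace QuadratureRule

theorem sum_add (Q : QuadratureRule d m) (u v : S d → ℝ) : Q.sum (u + v) = Q.sum u + Q.sum v := by
  simp [QuadratureRule.sum, mul_add, Finset.sum_add_distrib]

theorem sum_smul (Q : QuadratureRule d m) (c : ℝ) (u : S d → ℝ) :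
    Q.sum (c • u) = c * Q.sum u := by
  simp [QuadratureRule.sum, Finset.mul_sum, mul_left_comm]

theorem sum_zero (Q : QuadratureRule d m) : Q.sum 0 = 0 := by
  simp [QuadratureRule.sum]

theorem sum_mono (Q : QuadratureRule d m) (h : ∀ x, u x ≤ v x) : Q.sum u ≤ Q.sum v :=
  Finset.sum_le_sum fun j _ => mul_le_mul_of_nonneg_left (h _) (Q.weight_pos j).le

theorem inner_eq (Q : QuadratureRule d m) (u v : S d → ℝ) : Q.inner u v = Q.sum (u * v) := rfl

theorem inner_comm (Q : QuadratureRule d m) (u v : S d → ℝ) : Q.inner u v = Q.inner v u := by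
  rw [inner_eq, inner_eq, mul_comm]

theorem inner_add_right (Q : QuadratureRule d m) (u v w : S d → ℝ) :
    Q.inner u (v + w) = Q.inner u v + Q.inner u w := by
  rw [inner_eq, mul_add, sum_add]; rfl

theorem inner_smul_right (Q : QuadratureRule d m) (c : ℝ) (u v : S d → ℝ) :
    Q.inner u (c • v) = c * Q.inner u v := by
  rw [inner_eq, mul_smul_comm, sum_smul]; rfl

theorem inner_zero_right (Q : QuadratureRule d m) (u : S d → ℝ) : Q.inner u 0 = 0 := by
  rw [inner_eq, mul_zero, sum_zero]

theorem inner_sum_left {ι : Type*} (Q : QuadratureRule d m) (s : Finset ι) (f : ι → S d → ℝ)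
    (v : S d → ℝ) : Q.inner (∑ i ∈ s, f i) v = ∑ i ∈ s, Q.inner (f i) v := by
  classical
  induction s using Finset.induction_on with
  | empty => rw [Finset.sum_empty, Finset.sum_empty, inner_comm, inner_zero_right]
  | insert a s ha ih =>
    rw [Finset.sum_insert ha, Finset.sum_insert ha, inner_comm, inner_add_right, inner_comm,
      inner_comm Q v, ih]

theorem HasExactness.mono {t s : ℕ} (h : Q.HasExactness t) (hst : s ≤ t) : Q.HasExactness s :=
  fun g hg => h g (sphericalPolynomials_mono hst hg)

/-- A discrete divergence theorem: the eigenvalue vanishes for l = 0, and exactness with zero mean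
handles l > 0. -/
theorem HasExactness.sum_laplaceBeltrami (h : Q.HasExactness N) (hY : IsHarmonicBasis Y)
    (hd : 0 < d) (hu : u ∈ sphericalPolynomials d N) : Q.sum (laplaceBeltrami u) = 0 := by
  refine hY.induction hd (motive := fun u => Q.sum (laplaceBeltrami u) = 0) ?_ ?_ ?_ ?_ hu
  · intro l hl k
    rw [hY.laplaceBeltrami_eq, sum_smul]
    rcases eq_or_ne l 0 with rfl | h0
    · simp
    · rw [h _ (hY.mem_sphericalPolynomials hl k), hY.integral_eq_zero hd h0, mul_zero]
  · rw [laplaceBeltrami_zero, sum_zero]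
  · intro v hv w hw h1 h2
    rw [laplaceBeltrami_add hv hw, sum_add, h1, h2, add_zero]
  · intro c v hv h1
    rw [laplaceBeltrami_smul c hv, sum_smul, h1, mul_zero]

theorem HasExactness.inner_basis (h : Q.HasExactness (2 * N)) (hY : IsHarmonicBasis Y)
    (a b : (l : ℕ) × Fin (Z d l)) (ha : a.1 ≤ N) (hb : b.1 ≤ N) :
    Q.inner (Y a.1 a.2) (Y b.1 b.2) = if a = b then 1 else 0 := by
  rw [← hY.orthonormal, inner_eq, h]
  · rfl
  · rw [two_mul]
    exact mul_mem_sphericalPolynomials (hY.mem_sphericalPolynomials ha a.2)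
      (hY.mem_sphericalPolynomials hb b.2)

/-- The Laplacian is diagonal with real eigenvalues in a basis that is orthonormal for the discrete
product. -/
theorem HasExactness.inner_laplaceBeltrami_comm (h : Q.HasExactness (2 * N))
    (hY : IsHarmonicBasis Y) (hd : 0 < d) (hu : u ∈ sphericalPolynomials d N)
    (hv : v ∈ sphericalPolynomials d N) :
    Q.inner u (laplaceBeltrami v) = Q.inner v (laplaceBeltrami u) := by
  refine hY.induction hd (motive := fun u =>
    Q.inner u (laplaceBeltrami v) = Q.inner v (laplaceBeltrami u)) ?_ ?_ ?_ ?_ hu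
  · intro l hl k
    refine hY.induction hd (motive := fun v =>
      Q.inner (Y l k) (laplaceBeltrami v) = Q.inner v (laplaceBeltrami (Y l k))) ?_ ?_ ?_ ?_ hv
    · intro l' hl' k'
      rw [hY.laplaceBeltrami_eq, hY.laplaceBeltrami_eq, inner_smul_right, inner_smul_right,
        h.inner_basis hY ⟨l, k⟩ ⟨l', k'⟩ hl hl', h.inner_basis hY ⟨l', k'⟩ ⟨l, k⟩ hl' hl]
      by_cases he : (⟨l, k⟩ : (l : ℕ) × Fin (Z d l)) = ⟨l', k'⟩
      · rw [if_pos he, if_pos he.symm, show l = l' from congrArg Sigma.fst he]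
      · rw [if_neg he, if_neg (Ne.symm he), mul_zero, mul_zero]
    · rw [laplaceBeltrami_zero, inner_zero_right, inner_comm, inner_zero_right]
    · intro v hv w hw h1 h2
      rw [laplaceBeltrami_add hv hw, inner_add_right, h1, h2, inner_comm Q (v + w),
        inner_add_right, inner_comm Q v, inner_comm Q w]
    · intro c v hv h1
      rw [laplaceBeltrami_smul c hv, inner_smul_right, h1, inner_comm Q (c • v),
        inner_smul_right, inner_comm Q v]
  · rw [laplaceBeltrami_zero, inner_zero_right, inner_comm, inner_zero_right]
  · intro u hu w hw h1 h2
    rw [laplaceBeltrami_add hu hw, inner_add_right, ← h1, ← h2, inner_comm Q (u + w),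
      inner_add_right, inner_comm Q u, inner_comm Q w]
  · intro c u hu h1
    rw [laplaceBeltrami_smul c hu, inner_smul_right, ← h1, inner_comm Q (c • u),
      inner_smul_right, inner_comm Q u]

/-- Discrete Green's identity for spherical polynomials. -/
theorem HasExactness.inner_laplaceBeltrami (h : Q.HasExactness (2 * N))
    (hY : IsHarmonicBasis Y) (hd : 0 < d) (hu : u ∈ sphericalPolynomials d N)
    (hv : v ∈ sphericalPolynomials d N) :
    Q.inner (laplaceBeltrami u) v =
      -Q.sum fun x => Inner.inner ℝ (sphereGrad u x) (sphereGrad v x) := by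
  have hprod : laplaceBeltrami (u * v) = u * laplaceBeltrami v + v * laplaceBeltrami u
      + (2 : ℝ) • fun x => Inner.inner ℝ (sphereGrad u x) (sphereGrad v x) :=
    funext fun x => laplaceBeltrami_mul hu hv x
  have huv : u * v ∈ sphericalPolynomials d (2 * N) := by
    rw [two_mul]
    exact mul_mem_sphericalPolynomials hu hv
  have hz := h.sum_laplaceBeltrami hY hd huv
  -- By symmetry the first two terms agree, leaving twice the claimed identity.
  rw [hprod, sum_add, sum_add, sum_smul, ← inner_eq, ← inner_eq,
    h.inner_laplaceBeltrami_comm hY hd hu hv] at hz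
  rw [inner_comm]
  linarith

/-- L_N is the orthogonal projection onto P_N for the discrete product, whatever the function f. -/
theorem HasExactness.inner_hyperinterpolation (h : Q.HasExactness (2 * N))
    (hY : IsHarmonicBasis Y) (hd : 0 < d) (f : S d → ℝ) (hv : v ∈ sphericalPolynomials d N) :
    Q.inner (hyperinterpolation Q Y N f) v = Q.inner f v := by
  refine hY.induction hd (motive := fun v =>
    Q.inner (hyperinterpolation Q Y N f) v = Q.inner f v) ?_ ?_ ?_ ?_ hv
  · intro l hl k
    have he : hyperinterpolation Q Y N f =
        ∑ a ∈ (Finset.range (N + 1)).sigma fun l => (Finset.univ : Finset (Fin (Z d l))),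
          Q.inner f (Y a.1 a.2) • Y a.1 a.2 := by
      funext x
      simp [hyperinterpolation, Finset.sum_sigma]
    rw [he, inner_sum_left, Finset.sum_eq_single ⟨l, k⟩]
    · rw [inner_comm, inner_smul_right, h.inner_basis hY ⟨l, k⟩ ⟨l, k⟩ hl hl, if_pos rfl, mul_one]
    · intro a ha hne
      rw [Finset.mem_sigma, Finset.mem_range] at ha
      rw [inner_comm, inner_smul_right, h.inner_basis hY ⟨l, k⟩ a hl (by omega),
        if_neg hne.symm, mul_zero]
    · intro hn
      exact absurd (Finset.mem_sigma.2 ⟨Finset.mem_range.2 (Nat.lt_succ_of_le hl), Finset.mem_univ _⟩) hn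
  · rw [inner_zero_right, inner_zero_right]
  · intro v _ w _ h1 h2
    rw [inner_add_right, inner_add_right, h1, h2]
  · intro c v _ h1
    rw [inner_smul_right, inner_smul_right, h1]

end QuadratureRule

/-! ### Energy estimate -/

/-- Exact Taylor expansion of the quartic F at a. The weights 3/4, 1/2, 1/4 of a², ab, b² sum to
3/2, whence the constant. -/
theorem F_sub_le {a b M : ℝ} (ha : a ^ 2 ≤ M) (hb : b ^ 2 ≤ M) :
    F b - F a ≤ (a ^ 3 - a) * (b - a) + (3 / 2 * M - 1 / 2) * (b - a) ^ 2 := by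
  have hM : 3 / 4 * a ^ 2 + 1 / 2 * (a * b) + 1 / 4 * b ^ 2 ≤ 3 / 2 * M := by
    nlinarith [sq_nonneg (a - b)]
  have h := mul_le_mul_of_nonneg_right hM (sq_nonneg (b - a))
  have he : F b - F a - (a ^ 3 - a) * (b - a) + 1 / 2 * (b - a) ^ 2 =
      (3 / 4 * a ^ 2 + 1 / 2 * (a * b) + 1 / 4 * b ^ 2) * (b - a) ^ 2 := by
    simp only [F]; ring
  linarith

/-- The two sides differ by c/2 |h - g|². -/
theorem half_inner_sub_le {E : Type*} [NormedAddCommGroup E] [InnerProductSpace ℝ E] (g h : E)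
    {c : ℝ} (hc : 0 ≤ c) :
    c / 2 * Inner.inner ℝ h h - c / 2 * Inner.inner ℝ g g ≤ c * Inner.inner ℝ h (h - g) := by
  have h1 : 0 ≤ Inner.inner ℝ (h - g) (h - g) := real_inner_self_nonneg
  rw [inner_sub_right, inner_sub_left, inner_sub_left] at h1
  rw [inner_sub_right]
  rw [real_inner_comm h g] at h1
  nlinarith [mul_nonneg hc h1, real_inner_comm h g]

theorem sq_le_max_supNorm (hu : Continuous u) (x : S d) : u x ^ 2 ≤ supNorm u ^ 2 := by
  rw [← sq_abs]
  exact pow_le_pow_left₀ (abs_nonneg _) (abs_le_supNorm hu x) 2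

theorem discreteEnergy_step_le (hd : 0 < d) (hY : IsHarmonicBasis Y) {τ ν : ℝ}
    (h : Q.HasExactness (2 * N)) (hu : u ∈ sphericalPolynomials d N)
    (hv : v ∈ sphericalPolynomials d N)
    (hstep : ∀ x, (v x - u x) / τ = ν ^ 2 * laplaceBeltrami v x
      - hyperinterpolation Q Y N (fun y => u y ^ 3 - u y) x) :
    discreteEnergy Q ν v - discreteEnergy Q ν u
        + (1 / τ + 1 / 2) * Q.sum (fun x => (v x - u x) ^ 2)
      ≤ 3 / 2 * max (supNorm u ^ 2) (supNorm v ^ 2) * Q.sum (fun x => (v x - u x) ^ 2) := by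
  set M := max (supNorm u ^ 2) (supNorm v ^ 2) with hM
  set f : S d → ℝ := fun y => u y ^ 3 - u y with hf
  set e : S d → ℝ := v - u with he
  set D : S d → ℝ := fun x => Inner.inner ℝ (sphereGrad v x) (sphereGrad e x) with hD
  have hemem : e ∈ sphericalPolynomials d N := sub_mem hv hu
  have hgreen := h.inner_laplaceBeltrami hY hd hv hemem
  have hhyp := h.inner_hyperinterpolation hY hd f hemem
  -- The scheme multiplied by e and summed over the nodes.
  have htest : 1 / τ * Q.sum (e * e) = ν ^ 2 * Q.inner (laplaceBeltrami v) e - Q.inner f e := by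
    rw [← hhyp, QuadratureRule.inner_eq, QuadratureRule.inner_eq, ← QuadratureRule.sum_smul,
      ← QuadratureRule.sum_smul, sub_eq_add_neg, ← neg_one_mul, ← QuadratureRule.sum_smul,
      ← QuadratureRule.sum_add]
    congr 1
    funext x
    have := hstep x
    simp only [Pi.add_apply, Pi.smul_apply, Pi.mul_apply, Pi.sub_apply, smul_eq_mul, he]
    rw [show 1 / τ * ((v x - u x) * (v x - u x)) = (v x - u x) / τ * (v x - u x) by ring, this]
    ring
  -- The two pointwise bounds, summed with positive weights; `htest` then turns the ν² and f terms
  -- into -1/τ times the sum of e².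
  have hpoint : Q.sum ((fun x => ν ^ 2 / 2 * (Inner.inner ℝ (sphereGrad v x) (sphereGrad v x))
      + F (v x)) + (-1 : ℝ) • fun x => ν ^ 2 / 2 *
      (Inner.inner ℝ (sphereGrad u x) (sphereGrad u x)) + F (u x)) ≤
      Q.sum (ν ^ 2 • D + f * e + (3 / 2 * M - 1 / 2) • (e * e)) := by
    refine Q.sum_mono fun x => ?_
    have h1 := F_sub_le (a := u x) (b := v x) (M := M)
      ((sq_le_max_supNorm (continuous_of_mem_sphericalPolynomials hu) x).trans (le_max_left _ _))
      ((sq_le_max_supNorm (continuous_of_mem_sphericalPolynomials hv) x).trans (le_max_right _ _))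
    have h2 := half_inner_sub_le (sphereGrad u x) (sphereGrad v x) (sq_nonneg ν)
    rw [← sphereGrad_sub hv hu x] at h2
    simp only [Pi.add_apply, Pi.smul_apply, Pi.mul_apply, smul_eq_mul, hD, he, hf, Pi.sub_apply]
    linarith
  simp only [QuadratureRule.sum_add, QuadratureRule.sum_smul] at hpoint
  have hsq : (fun x => (v x - u x) ^ 2) = e * e := by
    funext x
    simp [he, sq]
  rw [hsq]
  simp only [discreteEnergy]
  rw [hgreen] at htest
  rw [QuadratureRule.inner_eq] at htest
  linarith

/-! ### Exactness of the discrete energy -/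

/-- The product rule gives 2|∇u|² = Δ(u²) - 2uΔu, and the Laplacian preserves degree bounds. -/
theorem inner_sphereGrad_mem (hd : 0 < d) (hY : IsHarmonicBasis Y)
    (hu : u ∈ sphericalPolynomials d N) :
    (fun x => Inner.inner ℝ (sphereGrad u x) (sphereGrad u x)) ∈
      sphericalPolynomials d (2 * N) := by
  have hmul : ∀ {v w}, v ∈ sphericalPolynomials d N → w ∈ sphericalPolynomials d N →
      v * w ∈ sphericalPolynomials d (2 * N) := fun hv hw => by
    rw [two_mul]
    exact mul_mem_sphericalPolynomials hv hw
  have hΔ := hY.laplaceBeltrami_mem hd hu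
  have he : (fun x => Inner.inner ℝ (sphereGrad u x) (sphereGrad u x)) =
      (1 / 2 : ℝ) • (laplaceBeltrami (u * u) - (2 : ℝ) • (u * laplaceBeltrami u)) := by
    funext x
    simp only [Pi.smul_apply, Pi.sub_apply, Pi.mul_apply, smul_eq_mul, laplaceBeltrami_mul hu hu x]
    ring
  rw [he]
  exact Submodule.smul_mem _ _ (sub_mem (hY.laplaceBeltrami_mem hd (hmul hu hu))
    (Submodule.smul_mem _ _ (hmul hu hΔ)))

theorem F_comp_mem (hu : u ∈ sphericalPolynomials d N) :
    (fun x => F (u x)) ∈ sphericalPolynomials d (4 * N) := by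
  have h2 : u * u - (fun _ => 1) ∈ sphericalPolynomials d (N + N) :=
    sub_mem (mul_mem_sphericalPolynomials hu hu) (const_mem_sphericalPolynomials 1 _)
  have h4 := Submodule.smul_mem _ (1 / 4 : ℝ) (mul_mem_sphericalPolynomials h2 h2)
  rw [show N + N + (N + N) = 4 * N by ring] at h4
  convert! h4 using 1
  funext x
  simp only [F, Pi.smul_apply, Pi.mul_apply, Pi.sub_apply, smul_eq_mul]
  ring

/-- The whole energy density is a spherical polynomial; the quartic F(u) dictates the degree 4N. -/
theorem energy_eq_discreteEnergy (hd : 0 < d) (hY : IsHarmonicBasis Y)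
    (h : Q.HasExactness (4 * N)) (ν : ℝ) (hu : u ∈ sphericalPolynomials d N) :
    energy ν u = discreteEnergy Q ν u := by
  have hmem : (ν ^ 2 / 2) • (fun x => Inner.inner ℝ (sphereGrad u x) (sphereGrad u x))
      + (fun x => F (u x)) ∈ sphericalPolynomials d (4 * N) :=
    add_mem (Submodule.smul_mem _ _ (sphericalPolynomials_mono (by omega)
      (inner_sphereGrad_mem hd hY hu))) (F_comp_mem hu)
  have := h _ hmem
  refine Eq.trans ?_ this.symm
  simp only [energy]
  congr 1
  funext x
  simp only [Pi.add_apply, Pi.smul_apply, smul_eq_mul, real_inner_self_eq_norm_sq]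
  ring

end AllenCahnSphere

end

theorem mainTheorem7 (d : ℕ) (hd : 3 ≤ d) (m : ℕ) (Q : QuadratureRule d m)
    (Y : (l : ℕ) → Fin (Z d l) → S d → ℝ) (hY : IsHarmonicBasis Y)
    (N : ℕ) (τ : ℝ) (hτ : 0 < τ) (ν : ℝ) (u₀ : S d → ℝ) (u : ℕ → S d → ℝ)
    (hu : IsSchemeSolution Q Y N τ ν u₀ u) :
    (Q.HasExactness (2 * N) → ∀ n : ℕ,
      discreteEnergy Q ν (u (n + 1)) - discreteEnergy Q ν (u n)
          + (1 / τ + 1 / 2) * Q.sum (fun x => (u (n + 1) x - u n x) ^ 2)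
        ≤ 3 / 2 * max (supNorm (u n) ^ 2) (supNorm (u (n + 1)) ^ 2)
          * Q.sum (fun x => (u (n + 1) x - u n x) ^ 2)) ∧
    (Q.HasExactness (4 * N) → ∀ n : ℕ,
      energy ν (u (n + 1)) - energy ν (u n)
          + (1 / τ + 1 / 2) * ∫ x, (u (n + 1) x - u n x) ^ 2 ∂(surfaceMeasure d)
        ≤ 3 / 2 * max (supNorm (u n) ^ 2) (supNorm (u (n + 1)) ^ 2)
          * ∫ x, (u (n + 1) x - u n x) ^ 2 ∂(surfaceMeasure d)) := by
  have hd0 : 0 < d := by omega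
  have key : Q.HasExactness (2 * N) → ∀ n : ℕ, _ := fun h n =>
    discreteEnergy_step_le hd0 hY h (hu.mem n) (hu.mem (n + 1)) (hu.step n)
  refine ⟨key, fun h n => ?_⟩
  have hsq : (fun x => (u (n + 1) x - u n x) ^ 2) ∈ sphericalPolynomials d (4 * N) := by
    have he := sub_mem (hu.mem (n + 1)) (hu.mem n)
    refine sphericalPolynomials_mono (m := N + N) (by omega) ?_
    convert! mul_mem_sphericalPolynomials he he using 1
    funext x
    simp [sq]
  rw [energy_eq_discreteEnergy hd0 hY h ν (hu.mem n),
    energy_eq_discreteEnergy hd0 hY h ν (hu.mem (n + 1)), ← h _ hsq]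
  exact key (h.mono (by omega)) n
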